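/- For a positive integer $n$ let $\Omega_n=\{0,\pm1,\dots,\pm n\}$ and let $\mathfrak{B}_n$ be the hyperoctahedral group of signed permutations, i.e. of bijections $\pi:\Omega_n\to\Omega_n$ with $\pi(-a)=-\pi(a)$ for all $a\in\Omega_n$; write $\pi_i=\pi(i)$ for $0\le i\le n$, so that $\pi_0=0$. Besides the natural order $<$ on $\mathbb{Z}$ consider the $r$-order $-1<_r-2<_r-3<_r\cdots<_r0<_r1<_r2<_r\cdots$. Put $$\mathrm{des}^B(\pi)=|\{0\le i\le n-1:\pi_i>\pi_{i+1}\}|,\qquad \mathrm{des}_B(\pi)=|\{0\le i\le n-1:\pi_i>_r\pi_{i+1}\}|,$$ $\mathrm{ides}^B(\pi)=\mathrm{des}^B(\pi^{-1})$ and $\mathrm{ides}_B(\pi)=\mathrm{des}_B(\pi^{-1})$. Let $\mathcal{I}_n^B=\{\pi\in\mathfrak{B}_n:\pi^{-1}=\pi\}$ be the set of signed involutions and let $\mathcal{J}_n^B$ be the set of those $\pi\in\mathcal{I}_n^B$ with $\pi(i)\ne i$ and $\pi(i)\neq -i$ for all $1\le i\le n$ (the fixed-point-free signed involutions). Two statistics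 are equidistributed over a finite set $S$ if they take each value equally often on $S$. Then for every positive integer $n$: 1. The pairs $(\mathrm{des}^B,\mathrm{ides}^B)$ and $(\mathrm{des}_B,\mathrm{ides}_B)$ are equidistributed over $\mathfrak{B}_n$, and both define the same two-sided $\mathfrak{B}_n$-Eulerian polynomial: $$\sum_{\pi\in\mathfrak{B}_n}s^{\mathrm{des}^B(\pi)}t^{\mathrm{ides}^B(\pi)}=\sum_{\pi\in\mathfrak{B}_n}s^{\mathrm{des}_B(\pi)}t^{\mathrm{ides}_B(\pi)}\quad\text{in }\mathbb{Z}[s,t].$$ 2. The statistics $\mathrm{des}^B$ and $\mathrm{des}_B$ are equidistributed over $\mathcal{I}_n^B$, and so are the pairs $(\mathrm{des}^B,\mathrm{ides}^B)$ and $(\mathrm{des}_B,\mathrm{ides}_B)$; moreover $$\sum_{\pi\in\mathcal{I}_n^B}t^{\mathrm{des}^B(\pi)}=\sum_{\pi\in\mathcal{I}_n^B}t^{\mathrm{des}_B(\pi)}\quad\text{in }\mathbb{Z}[t].$$ 3. If $n$ is odd, then $\mathcal{J}_n^B=\emptyset$. If $n$ is even, then $\mathrm{des}^B$ and $\mathrm{des}_B$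 are not equidistributed over $\mathcal{J}_n^B$, and neither are the pairs $(\mathrm{des}^B,\mathrm{ides}^B)$ and $(\mathrm{des}_B,\mathrm{ides}_B)$. -/

import Mathlib

/-- The set `Ω_n = {0, 1, -1, 2, -2, …, n, -n}`. -/
abbrev Omega (n : ℕ) : Type := {a : ℤ // -(n : ℤ) ≤ a ∧ a ≤ (n : ℤ)}

instance Omega.instFintype (n : ℕ) : Fintype (Omega n) :=
  Fintype.subtype (@Finset.Icc ℤ Int.instLinearOrder.toPreorder _ (-(n : ℤ)) (n : ℤ))
    (fun _ => Finset.mem_Icc)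

/-- The map `a ↦ -a` on `Ω_n`. -/
instance Omega.instNeg (n : ℕ) : Neg (Omega n) :=
  ⟨fun a => ⟨-a.1, neg_le_neg a.2.2, neg_le.mp a.2.1⟩⟩

/-- The element `i` of `Ω_n`, for `0 ≤ i ≤ n`. -/
def Omega.ofFin {n : ℕ} (i : Fin (n + 1)) : Omega n :=
  ⟨(i.1 : ℤ), by have := i.2; omega, by have := i.2; omega⟩

/-- The hyperoctahedral group `B_n`: the bijections `π : Ω_n → Ω_n` with `π(-a) = -π(a)` for all
`a ∈ Ω_n`, as a subgroup of the group of all permutations of `Ω_n`. -/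
def hyperoctahedral (n : ℕ) : Subgroup (Equiv.Perm (Omega n)) where
  carrier := {π | ∀ a : Omega n, π (-a) = -(π a)}
  mul_mem' := by
    intro π σ hπ hσ a
    rw [Equiv.Perm.mul_apply, Equiv.Perm.mul_apply, hσ, hπ]
  one_mem' := by
    intro a
    rfl
  inv_mem' := by
    intro π hπ a
    rw [Equiv.Perm.inv_eq_iff_eq, hπ]
    exact congrArg Neg.neg (π.apply_symm_apply a).symm

/-- The type of signed permutations of length `n`, i.e. of elements of `B_n`. -/
abbrev SignedPerm (n : ℕ) : Type := hyperoctahedral n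

instance SignedPerm.instFintype (n : ℕ) : Fintype (SignedPerm n) :=
  Subtype.fintype (fun π : Equiv.Perm (Omega n) => ∀ a : Omega n, π (-a) = -(π a))

/-- The entry `π_i = π(i)`, as an integer, for `0 ≤ i ≤ n` (so `π_0 = 0`). -/
def SignedPerm.entry {n : ℕ} (π : SignedPerm n) (i : Fin (n + 1)) : ℤ :=
  (π.1 (Omega.ofFin i)).1

/-- The `r`-order on `ℤ`: `-1 <_r -2 <_r -3 <_r ⋯ <_r 0 <_r 1 <_r 2 <_r ⋯`. -/
def rLT (a b : ℤ) : Prop :=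
  (a < 0 ∧ 0 ≤ b) ∨ (0 ≤ a ∧ a < b) ∨ (a < 0 ∧ b < 0 ∧ b < a)

instance rLT.instDecidable (a b : ℤ) : Decidable (rLT a b) :=
  inferInstanceAs (Decidable ((a < 0 ∧ 0 ≤ b) ∨ (0 ≤ a ∧ a < b) ∨ (a < 0 ∧ b < 0 ∧ b < a)))

namespace SignedPerm

/-- The descent set of `π` under the natural order: the `i ∈ {0, …, n-1}` with
`π_i > π_{i+1}`. -/
def DesNat {n : ℕ} (π : SignedPerm n) : Finset (Fin n) :=
  Finset.univ.filter (fun i => π.entry i.castSucc > π.entry i.succ)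

/-- The descent set of `π` under the `r`-order: the `i ∈ {0, …, n-1}` with
`π_i >_r π_{i+1}`. -/
def DesR {n : ℕ} (π : SignedPerm n) : Finset (Fin n) :=
  Finset.univ.filter (fun i => rLT (π.entry i.succ) (π.entry i.castSucc))

/-- The inverse descent set of `π` under the natural order. -/
def iDesNat {n : ℕ} (π : SignedPerm n) : Finset (Fin n) :=
  Finset.univ.filter (fun i => entry π⁻¹ i.castSucc > entry π⁻¹ i.succ)

/-- The inverse descent set of `π` under the `r`-order. -/
def iDesR {n : ℕ} (π : SignedPerm n) : Finset (Fin n) :=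
  Finset.univ.filter (fun i => rLT (entry π⁻¹ i.succ) (entry π⁻¹ i.castSucc))

/-- `des^B(π)`. -/
def desNat {n : ℕ} (π : SignedPerm n) : ℕ := π.DesNat.card

/-- `des_B(π)`. -/
def desR {n : ℕ} (π : SignedPerm n) : ℕ := π.DesR.card

/-- `ides^B(π)`. -/
def idesNat {n : ℕ} (π : SignedPerm n) : ℕ := π.iDesNat.card

/-- `ides_B(π)`. -/
def idesR {n : ℕ} (π : SignedPerm n) : ℕ := π.iDesR.card

end SignedPerm

/-- The set of signed involutions: the `π ∈ B_n` with `π⁻¹ = π`. -/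
def signedInvolutions (n : ℕ) : Finset (SignedPerm n) :=
  Finset.univ.filter (fun π => π⁻¹ = π)

/-- The set of fixed-point-free signed involutions: the signed involutions `π ∈ B_n` with
`π(i) ≠ i` and `π(i) ≠ -i` for every `i ∈ {1, …, n}`. -/
def fixedPointFreeSignedInvolutions (n : ℕ) : Finset (SignedPerm n) :=
  (signedInvolutions n).filter (fun π =>
    ∀ i : Fin n, π.entry i.succ ≠ (i.1 : ℤ) + 1 ∧ π.entry i.succ ≠ -((i.1 : ℤ) + 1))

/-- Two statistics `f` and `g` are equidistributed over the finite set `S` if they take every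
value equally often on `S`. -/
def Equidistributed {α β : Type*} [DecidableEq β] (S : Finset α) (f g : α → β) : Prop :=
  ∀ v : β, (S.filter (fun x => f x = v)).card = (S.filter (fun x => g x = v)).card

/-- The two-sided Eulerian polynomial `∑_{π ∈ B_n} s^{des^B(π)} t^{ides^B(π)}`, where `s` and `t`
are the variables `X 0` and `X 1`. -/
noncomputable def twoSidedEulerianNat (n : ℕ) : MvPolynomial (Fin 2) ℤ :=
  ∑ π : SignedPerm n, MvPolynomial.X 0 ^ π.desNat * MvPolynomial.X 1 ^ π.idesNat

/-- The polynomial `∑_{π ∈ B_n} s^{des_B(π)} t^{ides_B(π)}`. -/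
noncomputable def twoSidedEulerianR (n : ℕ) : MvPolynomial (Fin 2) ℤ :=
  ∑ π : SignedPerm n, MvPolynomial.X 0 ^ π.desR * MvPolynomial.X 1 ^ π.idesR

/-- The polynomial `∑ t^{des^B(π)}`, over all signed involutions `π ∈ B_n`. -/
noncomputable def involutionEulerianNat (n : ℕ) : Polynomial ℤ :=
  ∑ π ∈ signedInvolutions n, Polynomial.X ^ π.desNat

/-- The polynomial `∑ t^{des_B(π)}`, over all signed involutions `π ∈ B_n`. -/
noncomputable def involutionEulerianR (n : ℕ) : Polynomial ℤ :=
  ∑ π ∈ signedInvolutions n, Polynomial.X ^ π.desR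

/-! ### Equidistribution -/

/-! Cut `1, …, n` into intervals, with a cut after each `i ∈ S`; a cut at `0 ∈ S` detaches the first
interval from `0`. Reflect these blocks to the negatives. Call `π` sorted for `(S, T)` if its
descents lie in `S` and those of `π⁻¹` in `T`, and record how many elements of each `S`-block go to
each `T`-block. For either order, a sorted `π` is determined by this matrix (`eq_of_blockCount_eq`).

The matrices that occur are the same for both orders (`exists_sorted_blockCount_eq`): among all
permutations with a given matrix, one maximising a suitable symmetric weight is sorted, and so is
its inverse. Hence sorted permutations are equinumerous for every `(S, T)`. Möbius inversion over
pairs of subsets then equidistributes the pairs of descent sets, and hence their sizes. Inversion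
transposes the matrix, so for `S = T` the correspondence preserves involutions.

For fixed-point-free involutions, an `r`-sorted one has no entries in blocks meeting the diagonal or
antidiagonal, so the correspondence from the `r`-order to the natural order keeps it
fixed-point-free. At descent number `1` this is an injection. It misses the permutation with entries
`-n, …, -1`, so the counts differ. -/

theorem equidistributed_iff_map_eq {α β : Type*} [DecidableEq β] (S : Finset α) (f g : α → β) :
    Equidistributed S f g ↔ S.val.map f = S.val.map g := by
  rw [Multiset.ext]
  refine forall_congr' fun v => ?_
  rw [Multiset.count_map, Multiset.count_map]
  simp only [Finset.card_def, Finset.filter_val, eq_comm]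

theorem Equidistributed.comp {α β γ : Type*} [DecidableEq β] [DecidableEq γ] {S : Finset α}
    {f g : α → β} (h : Equidistributed S f g) (k : β → γ) :
    Equidistributed S (fun x => k (f x)) (fun x => k (g x)) := by
  rw [equidistributed_iff_map_eq] at h ⊢
  have := congrArg (Multiset.map k) h
  simpa [Multiset.map_map, Function.comp_def] using this

theorem Equidistributed.sum_eq {α β M : Type*} [DecidableEq β] [AddCommMonoid M] {S : Finset α}
    {f g : α → β} (h : Equidistributed S f g) (k : β → M) :
    ∑ x ∈ S, k (f x) = ∑ x ∈ S, k (g x) := by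
  rw [equidistributed_iff_map_eq] at h
  have := congrArg (fun m => (Multiset.map k m).sum) h
  simpa [Multiset.map_map, Function.comp_def] using this

theorem Equidistributed.congr {α β : Type*} [DecidableEq β] {S : Finset α} {f g f' g' : α → β}
    (h : Equidistributed S f g) (hf : ∀ x ∈ S, f x = f' x) (hg : ∀ x ∈ S, g x = g' x) :
    Equidistributed S f' g' := by
  intro v
  rw [← Finset.filter_congr (fun x hx => by rw [hf x hx] : ∀ x ∈ S, (f x = v ↔ f' x = v)),
    ← Finset.filter_congr (fun x hx => by rw [hg x hx] : ∀ x ∈ S, (g x = v ↔ g' x = v))]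
  exact h v

/-- Statistics with values in a finite partial order are equidistributed as soon as they are
below each value equally often. -/
theorem equidistributed_of_card_le {α β : Type*} [Fintype β] [PartialOrder β] [DecidableEq β]
    [DecidableLE β] [DecidableLT β]
    (S : Finset α) (f g : α → β)
    (h : ∀ x, (S.filter (fun a => f a ≤ x)).card = (S.filter (fun a => g a ≤ x)).card) :
    Equidistributed S f g := by
  classical
  intro x
  induction x using WellFoundedLT.induction with
  | ind x ih =>
    -- The terms with `y < x` agree by induction and cancel.
    have key : ∀ k : α → β, (S.filter (fun a => k a ≤ x)).card =
        (S.filter (fun a => k a = x)).card +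
          ∑ y ∈ Finset.univ.filter (fun y => y < x), (S.filter (fun a => k a = y)).card := by
      intro k
      have h1 : S.filter (fun a => k a ≤ x) =
          S.filter (fun a => k a = x) ∪ S.filter (fun a => k a < x) := by
        ext a
        simp only [Finset.mem_filter, Finset.mem_union, le_iff_eq_or_lt]
        tauto
      have h2 : Disjoint (S.filter (fun a => k a = x)) (S.filter (fun a => k a < x)) := by
        rw [Finset.disjoint_filter]
        intro a _ h1 h2
        exact absurd h1 h2.ne
      rw [h1, Finset.card_union_of_disjoint h2]
      congr 1
      rw [Finset.card_eq_sum_card_fiberwise (f := k)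
        (t := Finset.univ.filter (fun y => y < x)) (by intro a; simp)]
      refine Finset.sum_congr rfl fun y hy => ?_
      rw [Finset.filter_filter]
      congr 1
      refine Finset.filter_congr fun a _ => ?_
      simp only [Finset.mem_filter, Finset.mem_univ, true_and] at hy
      constructor
      · exact fun h => h.2
      · rintro rfl; exact ⟨hy, rfl⟩
    have h3 := h x
    rw [key f, key g, Finset.sum_congr rfl (fun y hy => ih y (by simpa using hy))] at h3
    omega

/-- Monotone functions on a finite set whose fibres have the same sizes are equal. -/
theorem eq_of_monotoneOn_of_card_fiber_eq {α : Type*} [LinearOrder α] (s : Finset α)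
    (u v : α → ℤ) (hu : MonotoneOn u s) (hv : MonotoneOn v s)
    (h : ∀ c, (s.filter (fun x => u x = c)).card = (s.filter (fun x => v x = c)).card) :
    ∀ a ∈ s, u a = v a := by
  have hle : ∀ c, (s.filter (fun x => u x ≤ c)).card = (s.filter (fun x => v x ≤ c)).card := by
    intro c
    have hm : s.val.map u = s.val.map v := (equidistributed_iff_map_eq s u v).1 h
    have := congrArg (fun m => Multiset.countP (fun y => y ≤ c) m) hm
    simpa [Multiset.countP_map, Finset.card_def] using this
  have main : ∀ u v : α → ℤ, MonotoneOn u s → MonotoneOn v s →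
      (∀ c, (s.filter (fun x => u x ≤ c)).card = (s.filter (fun x => v x ≤ c)).card) →
      ∀ a ∈ s, v a ≤ u a := by
    intro u v hu hv hle a ha
    by_contra! hlt
    have h1 : s.filter (fun x => x ≤ a) ⊆ s.filter (fun x => u x ≤ u a) := by
      intro x hx
      rw [Finset.mem_filter] at hx ⊢
      exact ⟨hx.1, hu hx.1 ha hx.2⟩
    have h2 : s.filter (fun x => v x ≤ u a) ⊂ s.filter (fun x => x ≤ a) := by
      rw [Finset.ssubset_iff_of_subset]
      · exact ⟨a, by simp [ha], by simp [hlt]⟩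
      · intro x hx
        rw [Finset.mem_filter] at hx ⊢
        refine ⟨hx.1, le_of_not_gt fun hax => ?_⟩
        have := hv ha hx.1 hax.le
        omega
    have := Finset.card_le_card h1
    have := Finset.card_lt_card h2
    have := hle (u a)
    omega
  intro a ha
  exact le_antisymm (main v u hv hu (fun c => (hle c).symm) a ha) (main u v hu hv hle a ha)

/-! ### The two orders -/

/-- A function on `{-(n+1), …, n+1}` that is increasing for the natural order (`b = false`) or for
the `r`-order (`b = true`). -/
def orderKey (n : ℕ) (b : Bool) (a : ℤ) : ℤ :=
  if b = true ∧ a < 0 then -((n : ℤ) + 2) - a else a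

theorem orderKey_false (n : ℕ) (a : ℤ) : orderKey n false a = a := by
  simp [orderKey]

theorem orderKey_true (n : ℕ) (a : ℤ) :
    orderKey n true a = if a < 0 then -((n : ℤ) + 2) - a else a := by
  simp [orderKey]

/-- The bound is `n + 1` rather than `n` because signed block indices reach `n + 1`. -/
theorem orderKey_injective {n : ℕ} {b : Bool} {x y : ℤ} (hx : |x| ≤ n + 1) (hy : |y| ≤ n + 1)
    (h : orderKey n b x = orderKey n b y) : x = y := by
  rw [abs_le] at hx hy
  cases b
  · simpa only [orderKey_false] using h
  · simp only [orderKey_true] at h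
    split_ifs at h <;> omega

theorem orderKey_true_lt_iff {n : ℕ} {x y : ℤ} (hx : |x| ≤ n + 1) (hy : |y| ≤ n + 1) :
    orderKey n true x < orderKey n true y ↔ rLT x y := by
  rw [abs_le] at hx hy
  simp only [orderKey_true]
  unfold rLT
  split_ifs <;> omega

/-! ### Blocks -/

/-- The number of elements of `S` below `p`. -/
def blockIndex {n : ℕ} (S : Finset (Fin n)) (p : ℕ) : ℕ :=
  (S.filter (fun i => i.1 < p)).card

theorem blockIndex_mono {n : ℕ} (S : Finset (Fin n)) : Monotone (blockIndex S) := by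
  intro p q h
  refine Finset.card_le_card fun i hi => ?_
  rw [Finset.mem_filter] at hi ⊢
  exact ⟨hi.1, by omega⟩

theorem blockIndex_le {n : ℕ} (S : Finset (Fin n)) (p : ℕ) : blockIndex S p ≤ n :=
  (Finset.card_filter_le _ _).trans ((Finset.card_le_univ S).trans_eq (Fintype.card_fin n))

theorem blockIndex_lt {n : ℕ} {S : Finset (Fin n)} {i : Fin n} (hi : i ∈ S) {p q : ℕ}
    (hp : p ≤ i.1) (hq : i.1 < q) : blockIndex S p < blockIndex S q := by
  refine Finset.card_lt_card ?_
  rw [Finset.ssubset_iff_of_subset]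
  · exact ⟨i, by simp [hi, hq], by simp [hp]⟩
  · intro j hj
    rw [Finset.mem_filter] at hj ⊢
    exact ⟨hj.1, by omega⟩

theorem blockIndex_succ_of_notMem {n : ℕ} {S : Finset (Fin n)} {i : Fin n} (hi : i ∉ S) :
    blockIndex S (i.1 + 1) = blockIndex S i.1 := by
  unfold blockIndex
  congr 1
  refine Finset.filter_congr fun j hj => ?_
  have : j ≠ i := fun h => hi (h ▸ hj)
  have : j.1 ≠ i.1 := fun h => this (Fin.ext h)
  omega

/-- The signed index of the block of `a`: positive, negative or zero as `a` is. -/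
def signedBlock {n : ℕ} (S : Finset (Fin n)) (a : ℤ) : ℤ :=
  if 0 < a then (blockIndex S a.natAbs : ℤ) + 1
  else if a < 0 then -((blockIndex S a.natAbs : ℤ) + 1) else 0

theorem signedBlock_neg {n : ℕ} (S : Finset (Fin n)) (a : ℤ) :
    signedBlock S (-a) = -signedBlock S a := by
  unfold signedBlock
  rw [Int.natAbs_neg]
  split_ifs <;> omega

theorem signedBlock_pos_iff {n : ℕ} (S : Finset (Fin n)) (a : ℤ) :
    0 < signedBlock S a ↔ 0 < a := by
  unfold signedBlock
  split_ifs <;> omega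

theorem signedBlock_lt_zero_iff {n : ℕ} (S : Finset (Fin n)) (a : ℤ) :
    signedBlock S a < 0 ↔ a < 0 := by
  unfold signedBlock
  split_ifs <;> omega

theorem abs_signedBlock_le {n : ℕ} (S : Finset (Fin n)) (a : ℤ) :
    |signedBlock S a| ≤ n + 1 := by
  have := blockIndex_le S a.natAbs
  rw [abs_le]
  unfold signedBlock
  split_ifs <;> omega

theorem signedBlock_of_pos {n : ℕ} (S : Finset (Fin n)) {a : ℤ} (ha : 0 < a) :
    signedBlock S a = (blockIndex S a.natAbs : ℤ) + 1 := if_pos ha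

/-- Passing to signed blocks keeps the sign and is weakly monotone in the absolute value, and both
orders compare integers through these data alone. -/
theorem orderKey_signedBlock_le {n : ℕ} {b : Bool} (S : Finset (Fin n)) {x y : ℤ}
    (hy : |y| ≤ n) (h : orderKey n b x ≤ orderKey n b y) :
    orderKey n b (signedBlock S x) ≤ orderKey n b (signedBlock S y) := by
  have h1 : x.natAbs ≤ y.natAbs → blockIndex S x.natAbs ≤ blockIndex S y.natAbs :=
    fun h => blockIndex_mono S h
  have h2 : y.natAbs ≤ x.natAbs → blockIndex S y.natAbs ≤ blockIndex S x.natAbs :=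
    fun h => blockIndex_mono S h
  have h3 := blockIndex_le S x.natAbs
  have h4 := blockIndex_le S y.natAbs
  rw [abs_le] at hy
  generalize hu : blockIndex S x.natAbs = u at *
  generalize hv : blockIndex S y.natAbs = v at *
  unfold signedBlock
  rw [hu, hv]
  cases b <;> simp only [orderKey_false, orderKey_true] at * <;> split_ifs at * <;> omega

/-! ### Signed permutations and sortedness on blocks -/

namespace Omega

theorem coe_neg {n : ℕ} (a : Omega n) : (-a).1 = -a.1 := rfl

theorem abs_le {n : ℕ} (a : Omega n) : |a.1| ≤ (n : ℤ) := _root_.abs_le.2 a.2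

theorem exists_ofFin_of_nonneg {n : ℕ} {a : Omega n} (ha : 0 ≤ a.1) :
    ∃ i : Fin (n + 1), Omega.ofFin i = a ∧ (i.1 : ℤ) = a.1 := by
  have := a.2.2
  refine ⟨⟨a.1.toNat, by omega⟩, Subtype.ext ?_, ?_⟩
  · change (a.1.toNat : ℤ) = a.1
    omega
  · change (a.1.toNat : ℤ) = a.1
    omega

end Omega

namespace SignedPerm

theorem map_neg {n : ℕ} (π : SignedPerm n) (a : Omega n) : π.1 (-a) = -π.1 a := π.2 a

theorem coe_inv_apply_apply {n : ℕ} (π : SignedPerm n) (a : Omega n) :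
    (π⁻¹).1 (π.1 a) = a := π.1.symm_apply_apply a

theorem apply_coe_inv_apply {n : ℕ} (π : SignedPerm n) (a : Omega n) :
    π.1 ((π⁻¹).1 a) = a := π.1.apply_symm_apply a

theorem coe_eq_zero_iff {n : ℕ} (π : SignedPerm n) (a : Omega n) : (π.1 a).1 = 0 ↔ a.1 = 0 := by
  have h : ∀ (σ : SignedPerm n) (c : Omega n), c.1 = 0 → (σ.1 c).1 = 0 := by
    intro σ c hc
    have h1 : -c = c := Subtype.ext (by rw [Omega.coe_neg, hc, neg_zero])
    have h2 := congrArg Subtype.val (σ.map_neg c)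
    rw [h1, Omega.coe_neg] at h2
    omega
  refine ⟨fun h0 => ?_, h π a⟩
  have := h π⁻¹ _ h0
  rwa [coe_inv_apply_apply] at this

theorem entry_zero {n : ℕ} (π : SignedPerm n) : π.entry 0 = 0 :=
  (π.coe_eq_zero_iff _).2 (by simp [Omega.ofFin])

theorem ext_of_pos {n : ℕ} {π σ : SignedPerm n}
    (h : ∀ a : Omega n, 0 < a.1 → (π.1 a).1 = (σ.1 a).1) : π = σ := by
  refine Subtype.ext (Equiv.ext fun a => Subtype.ext ?_)
  rcases lt_trichotomy a.1 0 with ha | ha | ha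
  · have h1 := h (-a) (by rw [Omega.coe_neg]; omega)
    rw [map_neg, map_neg, Omega.coe_neg, Omega.coe_neg] at h1
    omega
  · rw [(π.coe_eq_zero_iff a).2 ha, (σ.coe_eq_zero_iff a).2 ha]
  · exact h a ha

/-- The descent set of `π` for one of the two orders. -/
def Des {n : ℕ} (b : Bool) (π : SignedPerm n) : Finset (Fin n) :=
  Finset.univ.filter
    (fun i => orderKey n b (π.entry i.succ) < orderKey n b (π.entry i.castSucc))

theorem abs_entry_le {n : ℕ} (π : SignedPerm n) (i : Fin (n + 1)) : |π.entry i| ≤ (n : ℤ) :=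
  Omega.abs_le _

theorem Des_false {n : ℕ} (π : SignedPerm n) : Des false π = π.DesNat := by
  simp [Des, DesNat, orderKey_false]

theorem Des_true {n : ℕ} (π : SignedPerm n) : Des true π = π.DesR := by
  unfold Des DesR
  refine Finset.filter_congr fun i _ => ?_
  have h1 := π.abs_entry_le i.succ
  have h2 := π.abs_entry_le i.castSucc
  exact orderKey_true_lt_iff (by omega) (by omega)

theorem Des_subset_iff {n : ℕ} {b : Bool} {π : SignedPerm n} {S : Finset (Fin n)} :
    Des b π ⊆ S ↔
      ∀ i ∉ S, orderKey n b (π.entry i.castSucc) ≤ orderKey n b (π.entry i.succ) := by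
  simp only [Finset.subset_iff, Des, Finset.mem_filter, Finset.mem_univ, true_and]
  refine forall_congr' fun i => ?_
  rw [← not_lt]
  tauto

theorem orderKey_le_of_Des_subset {n : ℕ} {b : Bool} {π : SignedPerm n} {S : Finset (Fin n)}
    (h : Des b π ⊆ S) {p q : ℕ} (hpq : p ≤ q) (hq : q < n + 1)
    (hS : blockIndex S p = blockIndex S q) :
    orderKey n b (π.entry ⟨p, by omega⟩) ≤ orderKey n b (π.entry ⟨q, hq⟩) := by
  induction q, hpq using Nat.le_induction with
  | base => exact le_rfl
  | succ q hpq ih =>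
    have h1 := blockIndex_mono S hpq
    have h2 := blockIndex_mono S (Nat.le_add_right q 1)
    refine (ih (by omega) (by omega)).trans ?_
    have hi : (⟨q, by omega⟩ : Fin n) ∉ S := fun hi =>
      
      absurd (blockIndex_lt hi (le_refl q) (Nat.lt_add_one q)) (by omega)
    exact Des_subset_iff.1 h ⟨q, by omega⟩ hi

theorem orderKey_le_of_signedBlock_eq {n : ℕ} {b : Bool} {π : SignedPerm n} {S : Finset (Fin n)}
    (h : Des b π ⊆ S) {x y : Omega n} (hx : 0 < x.1) (hxy : x.1 ≤ y.1)
    (hS : signedBlock S x.1 = signedBlock S y.1) :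
    orderKey n b (π.1 x).1 ≤ orderKey n b (π.1 y).1 := by
  obtain ⟨i, rfl, hi⟩ := Omega.exists_ofFin_of_nonneg hx.le
  obtain ⟨j, rfl, hj⟩ := Omega.exists_ofFin_of_nonneg (hx.le.trans hxy)
  rw [signedBlock_of_pos S hx, signedBlock_of_pos S (hx.trans_le hxy), ← hi, ← hj,
    Int.natAbs_natCast, Int.natAbs_natCast] at hS
  exact orderKey_le_of_Des_subset h (by omega) j.2 (by omega)

/-- Signed block `1` has no element of `S` below it, so it is attached to `0`, and the values rise
from `π_0 = 0` along it. It is empty if `0 ∈ S`. -/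
theorem apply_pos_of_signedBlock_eq_one {n : ℕ} {b : Bool} {π : SignedPerm n}
    {S : Finset (Fin n)} (h : Des b π ⊆ S) {x : Omega n} (hx : signedBlock S x.1 = 1) :
    0 < (π.1 x).1 := by
  have hx0 : 0 < x.1 := (signedBlock_pos_iff S _).1 (by omega)
  have hne := mt (π.coe_eq_zero_iff x).1 hx0.ne'
  obtain ⟨i, rfl, hi⟩ := Omega.exists_ofFin_of_nonneg hx0.le
  rw [signedBlock_of_pos S hx0, ← hi, Int.natAbs_natCast] at hx
  have h0 : blockIndex S 0 = 0 := by simp [blockIndex]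
  have h1 := orderKey_le_of_Des_subset h (Nat.zero_le i.1) i.2 (by omega)
  have h2 : π.entry ⟨0, by omega⟩ = 0 := π.entry_zero
  rw [h2] at h1
  change orderKey n b 0 ≤ orderKey n b (π.1 (Omega.ofFin i)).1 at h1
  have h4 := Omega.abs_le (π.1 (Omega.ofFin i))
  rw [_root_.abs_le] at h4
  cases b
  · simp only [orderKey_false] at h1
    omega
  · simp only [orderKey_true, lt_irrefl, if_false] at h1
    split_ifs at h1 <;> omega

/-! ### Uniqueness: block counts determine a sorted permutation -/

/-- The number of `a` in the block `i` of `S` with `π(a)` in the block `j` of `T`. -/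
def blockCount {n : ℕ} (S T : Finset (Fin n)) (π : SignedPerm n) (i j : ℤ) : ℕ :=
  (Finset.univ.filter
    (fun a : Omega n => signedBlock S a.1 = i ∧ signedBlock T (π.1 a).1 = j)).card

theorem blockCount_inv {n : ℕ} (S T : Finset (Fin n)) (π : SignedPerm n) (i j : ℤ) :
    blockCount T S π⁻¹ j i = blockCount S T π i j := by
  unfold blockCount
  refine (Finset.card_bij (fun a _ => π.1 a) ?_ ?_ ?_).symm
  · intro a ha
    simp only [Finset.mem_filter, Finset.mem_univ, true_and] at ha ⊢
    rw [coe_inv_apply_apply]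
    exact ha.symm
  · intro a _ c _ h
    exact π.1.injective h
  · intro c hc
    simp only [Finset.mem_filter, Finset.mem_univ, true_and] at hc
    refine ⟨(π⁻¹).1 c, ?_, apply_coe_inv_apply π c⟩
    simp only [Finset.mem_filter, Finset.mem_univ, true_and]
    rw [apply_coe_inv_apply]
    exact hc.symm

theorem blockCount_eq_zero_iff {n : ℕ} (S T : Finset (Fin n)) (π : SignedPerm n) (i j : ℤ) :
    blockCount S T π i j = 0 ↔
      ∀ a : Omega n, signedBlock S a.1 = i → signedBlock T (π.1 a).1 ≠ j := by
  simp [blockCount, Finset.filter_eq_empty_iff]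

/-- The block of `π(a)` is determined by the block counts. -/
theorem signedBlock_apply_eq {n : ℕ} {b : Bool} {S T : Finset (Fin n)} {π σ : SignedPerm n}
    (hπ : Des b π ⊆ S) (hσ : Des b σ ⊆ S) (h : blockCount S T π = blockCount S T σ)
    (a : Omega n) : signedBlock T (π.1 a).1 = signedBlock T (σ.1 a).1 := by
  have main : ∀ a : Omega n, 0 < a.1 →
      signedBlock T (π.1 a).1 = signedBlock T (σ.1 a).1 := by
    intro a ha
    -- Along one block of `S` the block of the image is weakly increasing, and its fibre sizes come
    -- from one row of the matrix, so this monotone function is determined.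
    have hmono : ∀ τ : SignedPerm n, Des b τ ⊆ S →
        MonotoneOn (fun x : Omega n => orderKey n b (signedBlock T (τ.1 x).1))
          ((Finset.univ.filter (fun x : Omega n => signedBlock S x.1 = signedBlock S a.1)
            : Finset (Omega n)) : Set (Omega n)) := by
      intro τ hτ x hx y hy hxy
      simp only [Finset.coe_filter, Finset.mem_univ, true_and, Set.mem_ofPred_eq] at hx hy
      have hx0 : 0 < x.1 := by
        rwa [← signedBlock_pos_iff S, hx, signedBlock_pos_iff]
      exact orderKey_signedBlock_le T (Omega.abs_le _)
        (orderKey_le_of_signedBlock_eq hτ hx0 hxy (hx.trans hy.symm))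
    refine orderKey_injective (n := n) (b := b) (abs_signedBlock_le _ _)
      (abs_signedBlock_le _ _)
      (eq_of_monotoneOn_of_card_fiber_eq _ _ _ (hmono π hπ) (hmono σ hσ) ?_ a (by simp))
    intro c
    have hc : ∀ τ : SignedPerm n,
        ((Finset.univ.filter (fun x : Omega n => signedBlock S x.1 = signedBlock S a.1)).filter
          (fun x => orderKey n b (signedBlock T (τ.1 x).1) = c)).card =
        ∑ j ∈ (Finset.Icc (-(n + 1 : ℤ)) (n + 1)).filter (fun j => orderKey n b j = c),
          blockCount S T τ (signedBlock S a.1) j := by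
      intro τ
      rw [Finset.card_eq_sum_card_fiberwise (f := fun x => signedBlock T (τ.1 x).1)
        (t := (Finset.Icc (-(n + 1 : ℤ)) (n + 1)).filter (fun j => orderKey n b j = c))]
      · refine Finset.sum_congr rfl fun j hj => ?_
        rw [Finset.mem_filter] at hj
        unfold blockCount
        congr 1
        ext x
        simp only [Finset.mem_filter, Finset.mem_univ, true_and]
        constructor
        · rintro ⟨⟨h1, -⟩, h2⟩
          exact ⟨h1, h2⟩
        · rintro ⟨h1, h2⟩
          exact ⟨⟨h1, by rw [h2]; exact hj.2⟩, h2⟩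
      · intro x hx
        simp only [Finset.coe_filter, Finset.mem_filter, Finset.mem_univ, true_and,
          Set.mem_ofPred_eq] at hx
        simp only [Finset.coe_filter, Finset.mem_Icc, Set.mem_ofPred_eq]
        exact ⟨_root_.abs_le.1 (abs_signedBlock_le T _), hx.2⟩
    rw [hc π, hc σ, h]
  rcases lt_trichotomy a.1 0 with ha | ha | ha
  · have h1 := main (-a) (by rw [Omega.coe_neg]; omega)
    rw [map_neg, map_neg, Omega.coe_neg, Omega.coe_neg, signedBlock_neg, signedBlock_neg] at h1
    omega
  · rw [(π.coe_eq_zero_iff a).2 ha, (σ.coe_eq_zero_iff a).2 ha]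
  · exact main a ha

/-- A signed permutation is determined by its block counts once its descents and inverse descents
are at block boundaries. -/
theorem eq_of_blockCount_eq {n : ℕ} {b : Bool} {S T : Finset (Fin n)} {π σ : SignedPerm n}
    (hπ : Des b π ⊆ S) (hσ : Des b σ ⊆ S) (hπ' : Des b π⁻¹ ⊆ T) (hσ' : Des b σ⁻¹ ⊆ T)
    (h : blockCount S T π = blockCount S T σ) : π = σ := by
  -- By the transposed matrix, each value comes from the same `S`-block under `π` and `σ`. So both
  -- have the same image on each block, and sortedness fixes its arrangement.
  have hinv : ∀ v : Omega n,
      signedBlock S ((π⁻¹).1 v).1 = signedBlock S ((σ⁻¹).1 v).1 := by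
    refine signedBlock_apply_eq hπ' hσ' ?_
    funext j i
    rw [blockCount_inv, blockCount_inv, h]
  refine ext_of_pos fun a ha => ?_
  have hmono : ∀ τ : SignedPerm n, Des b τ ⊆ S →
      MonotoneOn (fun x : Omega n => orderKey n b (τ.1 x).1)
        ((Finset.univ.filter (fun x : Omega n => signedBlock S x.1 = signedBlock S a.1)
          : Finset (Omega n)) : Set (Omega n)) := by
    intro τ hτ x hx y hy hxy
    simp only [Finset.coe_filter, Finset.mem_univ, true_and, Set.mem_ofPred_eq] at hx hy
    have hx0 : 0 < x.1 := by
      rwa [← signedBlock_pos_iff S, hx, signedBlock_pos_iff]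
    exact orderKey_le_of_signedBlock_eq hτ hx0 hxy (hx.trans hy.symm)
  have habs : ∀ c : Omega n, |c.1| ≤ (n : ℤ) + 1 := fun c => by
    have := Omega.abs_le c
    omega
  refine orderKey_injective (n := n) (b := b) (habs _) (habs _)
    (eq_of_monotoneOn_of_card_fiber_eq _ _ _ (hmono π hπ) (hmono σ hσ) ?_ a (by simp))
  intro c
  have hc : ∀ τ : SignedPerm n,
      ((Finset.univ.filter (fun x : Omega n => signedBlock S x.1 = signedBlock S a.1)).filter
        (fun x => orderKey n b (τ.1 x).1 = c)).card =
      (Finset.univ.filter (fun v : Omega n =>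
        signedBlock S ((τ⁻¹).1 v).1 = signedBlock S a.1 ∧ orderKey n b v.1 = c)).card := by
    intro τ
    rw [Finset.filter_filter]
    refine Finset.card_bij (fun x _ => τ.1 x) ?_ (fun x _ y _ h => τ.1.injective h) ?_
    · intro x hx
      simp only [Finset.mem_filter, Finset.mem_univ, true_and] at hx ⊢
      rwa [coe_inv_apply_apply]
    · intro v hv
      simp only [Finset.mem_filter, Finset.mem_univ, true_and] at hv
      refine ⟨(τ⁻¹).1 v, ?_, apply_coe_inv_apply τ v⟩
      simp only [Finset.mem_filter, Finset.mem_univ, true_and]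
      rwa [apply_coe_inv_apply]
  rw [hc π, hc σ]
  simp only [hinv]

/-! ### Existence: permutations of maximal weight -/

/-- The map on `Ω_n` interchanging `p` with `p + 1` and `-p` with `-(p + 1)`. -/
def adjSwapFun {n : ℕ} (p : ℤ) (hp : 0 < p) (hpn : p + 1 ≤ n) (a : Omega n) : Omega n :=
  ⟨if a.1 = p then p + 1 else if a.1 = p + 1 then p
    else if a.1 = -p then -(p + 1) else if a.1 = -(p + 1) then -p else a.1, by
    have := a.2
    split_ifs <;> omega⟩

theorem adjSwapFun_involutive {n : ℕ} (p : ℤ) (hp : 0 < p) (hpn : p + 1 ≤ n) :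
    Function.Involutive (adjSwapFun (n := n) p hp hpn) := by
  intro a
  refine Subtype.ext ?_
  simp only [adjSwapFun]
  split_ifs <;> omega

/-- The adjacent transposition of `p` and `p + 1` in the hyperoctahedral group. -/
def adjSwap {n : ℕ} (p : ℤ) (hp : 0 < p) (hpn : p + 1 ≤ n) : SignedPerm n :=
  ⟨(adjSwapFun_involutive p hp hpn).toPerm, by
    intro a
    refine Subtype.ext ?_
    simp only [Function.Involutive.coe_toPerm, Omega.coe_neg, adjSwapFun]
    split_ifs <;> omega⟩

theorem adjSwap_apply {n : ℕ} (p : ℤ) (hp : 0 < p) (hpn : p + 1 ≤ n) (a : Omega n) :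
    ((adjSwap p hp hpn).1 a).1 = if a.1 = p then p + 1 else if a.1 = p + 1 then p
    else if a.1 = -p then -(p + 1) else if a.1 = -(p + 1) then -p else a.1 := rfl

theorem adjSwap_apply_apply {n : ℕ} (p : ℤ) (hp : 0 < p) (hpn : p + 1 ≤ n) (a : Omega n) :
    (adjSwap p hp hpn).1 ((adjSwap p hp hpn).1 a) = a :=
  adjSwapFun_involutive p hp hpn a

/-- A symmetric weight such that permutations of maximal total weight are sorted. -/
def pairWeight (n : ℕ) (b : Bool) (x y : ℤ) : ℤ :=
  (if b then |x * y| else x * y) + if 0 < x * y then (n : ℤ) * (|x| + |y|) else 0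

theorem pairWeight_comm (n : ℕ) (b : Bool) (x y : ℤ) :
    pairWeight n b x y = pairWeight n b y x := by
  unfold pairWeight
  rw [mul_comm x y, add_comm |x| |y|]

theorem pairWeight_neg_neg (n : ℕ) (b : Bool) (x y : ℤ) :
    pairWeight n b (-x) (-y) = pairWeight n b x y := by
  unfold pairWeight
  rw [neg_mul_neg, abs_neg, abs_neg]

theorem pairWeight_of_pos_of_pos {n : ℕ} {b : Bool} {x y : ℤ} (hx : 0 < x) (hy : 0 < y) :
    pairWeight n b x y = x * y + n * (x + y) := by
  unfold pairWeight
  have h := mul_pos hx hy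
  rw [if_pos h, abs_of_pos h, abs_of_pos hx, abs_of_pos hy, ite_self]

theorem pairWeight_of_pos_of_neg {n : ℕ} {b : Bool} {x y : ℤ} (hx : 0 < x) (hy : y < 0) :
    pairWeight n b x y = if b then -(x * y) else x * y := by
  unfold pairWeight
  have h := mul_neg_of_pos_of_neg hx hy
  rw [if_neg h.not_gt, abs_of_neg h, add_zero]

/-- For equal signs this is the rearrangement inequality; the absolute value in the `r`-case
reverses it on negatives. For `y < 0 < x` in the `r`-case the claim reduces to `-y < x + n`, which
is what the term with factor `n` provides. -/
theorem pairWeight_swap_lt {n : ℕ} {b : Bool} {p x y : ℤ} (hp : 0 < p) (hx : |x| ≤ n)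
    (hy : |y| ≤ n) (hx0 : x ≠ 0) (hy0 : y ≠ 0) (h : orderKey n b y < orderKey n b x) :
    pairWeight n b p x + pairWeight n b (p + 1) y <
      pairWeight n b (p + 1) x + pairWeight n b p y := by
  rw [abs_le] at hx hy
  have hp1 : 0 < p + 1 := by omega
  rcases lt_or_gt_of_ne hx0 with hx0 | hx0 <;> rcases lt_or_gt_of_ne hy0 with hy0 | hy0
  · rw [pairWeight_of_pos_of_neg hp hx0, pairWeight_of_pos_of_neg hp1 hx0,
      pairWeight_of_pos_of_neg hp hy0, pairWeight_of_pos_of_neg hp1 hy0]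
    cases b
    · simp only [orderKey_false, Bool.false_eq_true, if_false] at h ⊢
      linarith
    · simp only [orderKey_true, if_pos hx0, if_pos hy0, if_true] at h ⊢
      linarith
  · cases b
    · simp only [orderKey_false] at h
      omega
    · simp only [orderKey_true, if_pos hx0, if_neg hy0.not_gt] at h
      omega
  · rw [pairWeight_of_pos_of_pos hp hx0, pairWeight_of_pos_of_pos hp1 hx0,
      pairWeight_of_pos_of_neg hp hy0, pairWeight_of_pos_of_neg hp1 hy0]
    cases b
    · simp only [Bool.false_eq_true, if_false]
      linarith
    · simp only [if_true]
      linarith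
  · rw [pairWeight_of_pos_of_pos hp hx0, pairWeight_of_pos_of_pos hp1 hx0,
      pairWeight_of_pos_of_pos hp hy0, pairWeight_of_pos_of_pos hp1 hy0]
    have hxy : y < x := by
      cases b
      · simpa only [orderKey_false] using h
      · simpa only [orderKey_true, if_neg hx0.not_gt, if_neg hy0.not_gt] using h
    linarith

/-- The total weight of a signed permutation. -/
def totalWeight {n : ℕ} (b : Bool) (π : SignedPerm n) : ℤ :=
  ∑ a : Omega n, pairWeight n b a.1 (π.1 a).1

/-- This lets a single maximiser be sorted together with its inverse. -/
theorem totalWeight_inv {n : ℕ} (b : Bool) (π : SignedPerm n) :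
    totalWeight b π⁻¹ = totalWeight b π := by
  unfold totalWeight
  rw [← Equiv.sum_comp π.1]
  refine Finset.sum_congr rfl fun a _ => ?_
  rw [coe_inv_apply_apply, pairWeight_comm]

/-- Only the terms at `±p` and `±(p + 1)` change, and negation preserves `pairWeight`, so the gain
is twice that of `pairWeight_swap_lt`. -/
theorem totalWeight_lt_mul_adjSwap {n : ℕ} {b : Bool} {π : SignedPerm n} {p : ℤ} (hp : 0 < p)
    (hpn : p + 1 ≤ n) {u v : Omega n} (hu : u.1 = p) (hv : v.1 = p + 1)
    (h : orderKey n b (π.1 v).1 < orderKey n b (π.1 u).1) :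
    totalWeight b π < totalWeight b (π * adjSwap p hp hpn) := by
  set τ : SignedPerm n := adjSwap p hp hpn with hτ
  have hτu : (τ.1 u).1 = p + 1 := by rw [hτ, adjSwap_apply, if_pos hu]
  have hτv : (τ.1 v).1 = p := by rw [hτ, adjSwap_apply, if_neg (by omega), if_pos hv]
  let d : Omega n → ℤ := fun a =>
    pairWeight n b (τ.1 a).1 (π.1 a).1 - pairWeight n b a.1 (π.1 a).1
  have hdneg : ∀ a, d (-a) = d a := by
    intro a
    simp only [d, map_neg, Omega.coe_neg, pairWeight_neg_neg]
  have hsum : totalWeight b (π * τ) - totalWeight b π = ∑ a, d a := by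
    have h1 : totalWeight b (π * τ) = ∑ a : Omega n, pairWeight n b (τ.1 a).1 (π.1 a).1 := by
      unfold totalWeight
      rw [← Equiv.sum_comp τ.1 (fun a => pairWeight n b (τ.1 a).1 (π.1 a).1)]
      refine Finset.sum_congr rfl fun a _ => ?_
      rw [hτ, adjSwap_apply_apply]
      rfl
    rw [h1, Finset.sum_sub_distrib]
    rfl
  have hsub : ∑ a ∈ ({u, v, -u, -v} : Finset (Omega n)), d a = ∑ a, d a := by
    refine Finset.sum_subset (Finset.subset_univ _) fun a _ ha => ?_
    simp only [Finset.mem_insert, Finset.mem_singleton, not_or, Subtype.ext_iff,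
      Omega.coe_neg, hu, hv] at ha
    have h2 : (τ.1 a).1 = a.1 := by
      rw [hτ, adjSwap_apply, if_neg ha.1, if_neg ha.2.1, if_neg ha.2.2.1, if_neg ha.2.2.2]
    simp only [d, h2, sub_self]
  have hdis : ∑ a ∈ ({u, v, -u, -v} : Finset (Omega n)), d a = 2 * (d u + d v) := by
    have huv : u ≠ v := fun h => by rw [h] at hu; omega
    have e1 : ∀ a c : Omega n, 0 < a.1 → 0 < c.1 → a ≠ -c := by
      intro a c ha hc h
      have := congrArg Subtype.val h
      rw [Omega.coe_neg] at this
      omega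
    have huv' : -u ≠ -v := fun h => by
      have := congrArg Subtype.val h
      rw [Omega.coe_neg, Omega.coe_neg] at this
      omega
    rw [Finset.sum_insert, Finset.sum_insert, Finset.sum_insert, Finset.sum_singleton, hdneg,
      hdneg]
    · ring
    · simpa using huv'
    · simp only [Finset.mem_insert, Finset.mem_singleton, not_or]
      exact ⟨e1 _ _ (by omega) (by omega), e1 _ _ (by omega) (by omega)⟩
    · simp only [Finset.mem_insert, Finset.mem_singleton, not_or]
      exact ⟨huv, e1 _ _ (by omega) (by omega), e1 _ _ (by omega) (by omega)⟩
  have hlt := pairWeight_swap_lt hp (Omega.abs_le (π.1 u)) (Omega.abs_le (π.1 v))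
    (mt (π.coe_eq_zero_iff u).1 (by omega)) (mt (π.coe_eq_zero_iff v).1 (by omega)) h
  have hd : 0 < d u + d v := by
    simp only [d, hτu, hτv]
    rw [hu, hv]
    linarith
  linarith

theorem signedBlock_adjSwap {n : ℕ} {S : Finset (Fin n)} {p : ℤ} (hp : 0 < p) (hpn : p + 1 ≤ n)
    (hS : signedBlock S (p + 1) = signedBlock S p) (a : Omega n) :
    signedBlock S ((adjSwap p hp hpn).1 a).1 = signedBlock S a.1 := by
  rw [adjSwap_apply]
  split_ifs with h1 h2 h3 h4
  · rw [h1, hS]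
  · rw [h2, hS]
  · rw [h3, signedBlock_neg, signedBlock_neg, hS]
  · rw [h4, signedBlock_neg, signedBlock_neg, hS]
  · rfl

theorem blockCount_mul_adjSwap {n : ℕ} {S : Finset (Fin n)} (T : Finset (Fin n))
    (π : SignedPerm n) {p : ℤ} (hp : 0 < p) (hpn : p + 1 ≤ n)
    (hS : signedBlock S (p + 1) = signedBlock S p) :
    blockCount S T (π * adjSwap p hp hpn) = blockCount S T π := by
  funext i j
  unfold blockCount
  have h1 : ∀ a, signedBlock S ((adjSwap p hp hpn).1 a).1 = signedBlock S a.1 :=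
    signedBlock_adjSwap hp hpn hS
  refine Finset.card_bij (fun a _ => (adjSwap p hp hpn).1 a) ?_
    (fun x _ y _ h => (adjSwap p hp hpn).1.injective h) ?_
  · intro a ha
    simp only [Finset.mem_filter, Finset.mem_univ, true_and] at ha ⊢
    rw [h1]
    exact ha
  · intro c hc
    simp only [Finset.mem_filter, Finset.mem_univ, true_and] at hc
    refine ⟨(adjSwap p hp hpn).1 c, ?_, adjSwap_apply_apply p hp hpn c⟩
    simp only [Finset.mem_filter, Finset.mem_univ, true_and]
    rw [h1]
    refine ⟨hc.1, ?_⟩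
    change signedBlock T (π.1 ((adjSwap p hp hpn).1 ((adjSwap p hp hpn).1 c))).1 = j
    rw [adjSwap_apply_apply]
    exact hc.2

/-- A signed permutation of maximal weight with given block counts is sorted. -/
theorem Des_subset_of_totalWeight_max {n : ℕ} {b : Bool} {S T : Finset (Fin n)}
    {π : SignedPerm n} (hpos : ∀ j < 0, blockCount S T π 1 j = 0)
    (hmax : ∀ σ : SignedPerm n, blockCount S T σ = blockCount S T π →
      totalWeight b σ ≤ totalWeight b π) : Des b π ⊆ S := by
  rw [Des_subset_iff]
  intro i hi
  by_contra! hlt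
  -- Position `0` cannot be swapped: a descent there puts a negative value in block `1`, against
  -- `hpos`. At a later position the swap stays inside a block, keeps the matrix and raises the
  -- weight.
  rcases Nat.eq_zero_or_pos i.1 with h0 | h0
  · have hi0 : i.castSucc = 0 := Fin.ext h0
    rw [hi0, entry_zero] at hlt
    have h1 : (Omega.ofFin i.succ : Omega n).1 = 1 := by
      simp [Omega.ofFin, h0]
    have h2 : signedBlock S (Omega.ofFin i.succ : Omega n).1 = 1 := by
      have := blockIndex_succ_of_notMem hi
      rw [signedBlock_of_pos S (by omega), h1, Int.natAbs_one]
      rw [h0, zero_add] at this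
      rw [this]
      simp [blockIndex]
    have h3 : π.entry i.succ < 0 := by
      have := π.abs_entry_le i.succ
      rw [abs_le] at this
      cases b
      · simpa only [orderKey_false] using hlt
      · simp only [orderKey_true, lt_irrefl, if_false] at hlt
        split_ifs at hlt <;> omega
    exact (blockCount_eq_zero_iff S T π 1 _).1
      (hpos _ ((signedBlock_lt_zero_iff T _).2 h3)) _ h2 rfl
  · have hp : (0 : ℤ) < i.1 := by omega
    have hpn : (i.1 : ℤ) + 1 ≤ n := by have := i.2; omega
    have hS : signedBlock S ((i.1 : ℤ) + 1) = signedBlock S (i.1 : ℤ) := by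
      rw [signedBlock_of_pos S hp, signedBlock_of_pos S (by omega), Int.natAbs_natCast,
        show ((i.1 : ℤ) + 1).natAbs = i.1 + 1 by omega, blockIndex_succ_of_notMem hi]
    have h1 := hmax _ (blockCount_mul_adjSwap T π hp hpn hS)
    have h2 := totalWeight_lt_mul_adjSwap (π := π) hp hpn (u := Omega.ofFin i.castSucc)
      (v := Omega.ofFin i.succ) (by simp [Omega.ofFin]) (by simp [Omega.ofFin]) hlt
    omega

/-- Every system of block counts that is realised by a sorted permutation for one of the two
orders is realised by one for the other order. -/
theorem exists_sorted_blockCount_eq {n : ℕ} {b : Bool} (b' : Bool) {S T : Finset (Fin n)}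
    {π : SignedPerm n} (hπ : Des b π ⊆ S) (hπ' : Des b π⁻¹ ⊆ T) :
    ∃ σ : SignedPerm n, Des b' σ ⊆ S ∧ Des b' σ⁻¹ ⊆ T ∧
      blockCount S T σ = blockCount S T π := by
  classical
  -- In both orders `0` separates negatives from positives, so this condition on the matrix serves
  -- `b'` as well.
  have hpos : ∀ (S T : Finset (Fin n)) (π : SignedPerm n), Des b π ⊆ S →
      ∀ j < 0, blockCount S T π 1 j = 0 := by
    intro S T π hπ j hj
    rw [blockCount_eq_zero_iff]
    intro a ha h
    have h1 := apply_pos_of_signedBlock_eq_one hπ ha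
    rw [← h, signedBlock_lt_zero_iff] at hj
    omega
  obtain ⟨σ, hσ, hmax⟩ := Finset.exists_max_image
    (Finset.univ.filter (fun σ : SignedPerm n => blockCount S T σ = blockCount S T π))
    (totalWeight b') ⟨π, by simp⟩
  simp only [Finset.mem_filter, Finset.mem_univ, true_and] at hσ hmax
  have hinv : ∀ ρ : SignedPerm n, blockCount T S ρ = blockCount T S σ⁻¹ →
      blockCount S T ρ⁻¹ = blockCount S T π := by
    intro ρ h
    rw [← hσ]
    funext i j
    rw [blockCount_inv, h, blockCount_inv]
  refine ⟨σ, ?_, ?_, hσ⟩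
  · exact Des_subset_of_totalWeight_max (T := T) (fun j hj => by rw [hσ, hpos S T π hπ j hj])
      fun ρ hρ => hmax ρ (hρ.trans hσ)
  · refine Des_subset_of_totalWeight_max (T := S) (fun j hj => ?_) fun ρ hρ => ?_
    · rw [blockCount_inv, hσ, ← blockCount_inv, hpos T S _ hπ' j hj]
    · rw [totalWeight_inv, ← totalWeight_inv b' ρ]
      exact hmax _ (hinv ρ hρ)

/-- The matrix of an involution is symmetric, so `σ` and `σ⁻¹` are sorted with the same matrix. -/
theorem inv_eq_of_blockCount_eq {n : ℕ} {b : Bool} {S : Finset (Fin n)} {π σ : SignedPerm n}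
    (hπ : π⁻¹ = π) (hσ : Des b σ ⊆ S) (hσ' : Des b σ⁻¹ ⊆ S)
    (h : blockCount S S σ = blockCount S S π) : σ⁻¹ = σ := by
  refine eq_of_blockCount_eq hσ' hσ (by rwa [inv_inv]) hσ' ?_
  funext i j
  rw [blockCount_inv, h, ← blockCount_inv, hπ]

/-! ### From sorted permutations to descent statistics -/

/-- A family of signed permutations that is stable under the passage from one order to the other
has as many sorted members for both orders. -/
theorem card_sorted_eq {n : ℕ} (I : Finset (SignedPerm n)) (S T : Finset (Fin n))
    (hI : ∀ (b : Bool) (π σ : SignedPerm n), π ∈ I → Des b σ ⊆ S → Des b σ⁻¹ ⊆ T →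
      blockCount S T σ = blockCount S T π → σ ∈ I) :
    (I.filter (fun π => Des false π ⊆ S ∧ Des false π⁻¹ ⊆ T)).card =
      (I.filter (fun π => Des true π ⊆ S ∧ Des true π⁻¹ ⊆ T)).card := by
  classical
  have hle : ∀ b b' : Bool, (I.filter (fun π => Des b π ⊆ S ∧ Des b π⁻¹ ⊆ T)).card ≤
      (I.filter (fun π => Des b' π ⊆ S ∧ Des b' π⁻¹ ⊆ T)).card := by
    intro b b'
    have hex : ∀ π : SignedPerm n, ∃ σ : SignedPerm n, (Des b π ⊆ S ∧ Des b π⁻¹ ⊆ T) →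
        Des b' σ ⊆ S ∧ Des b' σ⁻¹ ⊆ T ∧ blockCount S T σ = blockCount S T π := by
      intro π
      by_cases h : Des b π ⊆ S ∧ Des b π⁻¹ ⊆ T
      · obtain ⟨σ, hσ⟩ := exists_sorted_blockCount_eq b' h.1 h.2
        exact ⟨σ, fun _ => hσ⟩
      -- A dummy value; only sorted `π` matter.
      · exact ⟨π, fun h' => absurd h' h⟩
    choose φ hφ using hex
    refine Finset.card_le_card_of_injOn φ ?_ ?_
    · intro π hπ
      rw [Finset.mem_coe, Finset.mem_filter] at hπ ⊢
      obtain ⟨h1, h2, h3⟩ := hφ π hπ.2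
      exact ⟨hI b' π _ hπ.1 h1 h2 h3, h1, h2⟩
    · intro π hπ ρ hρ h
      rw [Finset.mem_coe, Finset.mem_filter] at hπ hρ
      refine eq_of_blockCount_eq hπ.2.1 hρ.2.1 hπ.2.2 hρ.2.2 ?_
      rw [← (hφ π hπ.2).2.2, ← (hφ ρ hρ.2).2.2, h]
  exact le_antisymm (hle _ _) (hle _ _)

theorem equidistributed_Des_pair (n : ℕ) :
    Equidistributed (Finset.univ : Finset (SignedPerm n))
      (fun π => (Des false π, Des false π⁻¹)) (fun π => (Des true π, Des true π⁻¹)) := by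
  classical
  refine equidistributed_of_card_le _ _ _ ?_
  rintro ⟨S, T⟩
  simp only [Prod.mk_le_mk]
  convert card_sorted_eq Finset.univ S T (fun _ _ σ _ _ _ _ => Finset.mem_univ σ)

theorem mem_signedInvolutions {n : ℕ} {π : SignedPerm n} :
    π ∈ signedInvolutions n ↔ π⁻¹ = π := by
  simp [signedInvolutions]

theorem equidistributed_Des_signedInvolutions (n : ℕ) :
    Equidistributed (signedInvolutions n) (fun π => Des false π) (fun π => Des true π) := by
  classical
  refine equidistributed_of_card_le _ _ _ fun S => ?_
  have h := card_sorted_eq (signedInvolutions n) S S fun b π σ hπ h1 h2 h3 =>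
    mem_signedInvolutions.2 (inv_eq_of_blockCount_eq (mem_signedInvolutions.1 hπ) h1 h2 h3)
  have hb : ∀ b : Bool, (signedInvolutions n).filter (fun π => Des b π ≤ S) =
      (signedInvolutions n).filter (fun π => Des b π ⊆ S ∧ Des b π⁻¹ ⊆ S) := by
    intro b
    refine Finset.filter_congr fun π hπ => ?_
    rw [mem_signedInvolutions.1 hπ, and_self]
  convert h using 2
  · convert hb false
  · convert hb true

theorem desNat_eq {n : ℕ} (π : SignedPerm n) : (Des false π).card = π.desNat :=
  congrArg Finset.card π.Des_false

theorem desR_eq {n : ℕ} (π : SignedPerm n) : (Des true π).card = π.desR :=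
  congrArg Finset.card π.Des_true

theorem idesNat_eq {n : ℕ} (π : SignedPerm n) : (Des false π⁻¹).card = π.idesNat :=
  desNat_eq π⁻¹

theorem idesR_eq {n : ℕ} (π : SignedPerm n) : (Des true π⁻¹).card = π.idesR :=
  desR_eq π⁻¹

theorem equidistributed_des_pair (n : ℕ) :
    Equidistributed (Finset.univ : Finset (SignedPerm n))
      (fun π => (π.desNat, π.idesNat)) (fun π => (π.desR, π.idesR)) := by
  refine ((equidistributed_Des_pair n).comp (fun x => (x.1.card, x.2.card))).congr ?_ ?_
  · intro π _
    rw [desNat_eq, idesNat_eq]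
  · intro π _
    rw [desR_eq, idesR_eq]

theorem equidistributed_des_signedInvolutions (n : ℕ) :
    Equidistributed (signedInvolutions n) (fun π => π.desNat) (fun π => π.desR) := by
  have h := (equidistributed_Des_signedInvolutions n).comp Finset.card
  simpa only [desNat_eq, desR_eq] using h

theorem idesNat_eq_desNat {n : ℕ} {π : SignedPerm n} (h : π⁻¹ = π) : π.idesNat = π.desNat := by
  rw [← idesNat_eq, h, desNat_eq]

theorem idesR_eq_desR {n : ℕ} {π : SignedPerm n} (h : π⁻¹ = π) : π.idesR = π.desR := by
  rw [← idesR_eq, h, desR_eq]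

theorem equidistributed_des_pair_signedInvolutions (n : ℕ) :
    Equidistributed (signedInvolutions n)
      (fun π => (π.desNat, π.idesNat)) (fun π => (π.desR, π.idesR)) := by
  refine ((equidistributed_des_signedInvolutions n).comp (fun d => (d, d))).congr ?_ ?_
  · intro π hπ
    rw [idesNat_eq_desNat (mem_signedInvolutions.1 hπ)]
  · intro π hπ
    rw [idesR_eq_desR (mem_signedInvolutions.1 hπ)]

/-! ### Fixed-point-free involutions -/

theorem mem_fixedPointFreeSignedInvolutions {n : ℕ} {π : SignedPerm n} :
    π ∈ fixedPointFreeSignedInvolutions n ↔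
      π⁻¹ = π ∧ ∀ a : Omega n, 0 < a.1 → (π.1 a).1 ≠ a.1 ∧ (π.1 a).1 ≠ -a.1 := by
  rw [fixedPointFreeSignedInvolutions, Finset.mem_filter, mem_signedInvolutions]
  refine and_congr_right fun _ => ⟨fun h a ha => ?_, fun h i => ?_⟩
  · have h1 := a.2.2
    have h2 := h ⟨a.1.toNat - 1, by omega⟩
    have h3 : (Omega.ofFin (⟨a.1.toNat - 1, by omega⟩ : Fin n).succ : Omega n) = a :=
      Subtype.ext (by simp only [Omega.ofFin, Fin.succ_mk]; omega)
    rw [entry, h3] at h2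
    simp only at h2
    rwa [show (((a.1.toNat - 1 : ℕ) : ℤ) + 1) = a.1 by omega] at h2
  · have h1 := h (Omega.ofFin i.succ) (by simp only [Omega.ofFin, Fin.val_succ]; omega)
    simpa [entry, Omega.ofFin] using h1

theorem apply_apply_of_inv_eq {n : ℕ} {π : SignedPerm n} (h : π⁻¹ = π) (a : Omega n) :
    π.1 (π.1 a) = a := by
  have := π.coe_inv_apply_apply a
  rwa [h] at this

/-- The map `a ↦ |π(a)|` would be a fixed-point-free involution of `{1, …, n}`; summing `1` over it
in `ZMod 2` gives that `n` is even. -/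
theorem fixedPointFreeSignedInvolutions_eq_empty {n : ℕ} (hn : Odd n) :
    fixedPointFreeSignedInvolutions n = ∅ := by
  rw [Finset.eq_empty_iff_forall_notMem]
  intro π hπ
  obtain ⟨hinv, hfix⟩ := mem_fixedPointFreeSignedInvolutions.1 hπ
  let s : Finset ℤ := Finset.Icc 1 (n : ℤ)
  let f : ℤ → ℤ := fun a => if h : -(n : ℤ) ≤ a ∧ a ≤ n then |(π.1 ⟨a, h⟩).1| else 0
  have hf : ∀ (a : Omega n), f a.1 = |(π.1 a).1| := fun a => dif_pos a.2
  have hff : ∀ a : Omega n, 0 < a.1 → f (f a.1) = a.1 := by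
    intro a ha
    rw [hf]
    have h1 := apply_apply_of_inv_eq hinv a
    rcases abs_cases (π.1 a).1 with h | h
    · rw [h.1, hf, h1, abs_of_pos ha]
    · rw [h.1, ← Omega.coe_neg, hf, map_neg, h1, Omega.coe_neg, abs_neg, abs_of_pos ha]
  have hmem : ∀ a ∈ s, -(n : ℤ) ≤ a ∧ a ≤ n := fun a ha => by
    have := Finset.mem_Icc.1 ha
    omega
  have hpos : ∀ a ∈ s, 0 < a := fun a ha => by
    have := Finset.mem_Icc.1 ha
    omega
  have h := Finset.sum_involution (s := s) (f := fun _ => (1 : ZMod 2)) (fun a _ => f a)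
    (fun _ _ => by decide)
    (fun a ha _ h => by
      have h1 := hfix ⟨a, hmem a ha⟩ (hpos a ha)
      have h2 := hf ⟨a, hmem a ha⟩
      simp only at h h1 h2
      rw [h] at h2
      rcases abs_choice (π.1 ⟨a, hmem a ha⟩).1 with h3 | h3 <;> omega)
    (fun a ha => by
      have h1 := Omega.abs_le (π.1 ⟨a, hmem a ha⟩)
      have h2 := hf ⟨a, hmem a ha⟩
      have h3 := mt (π.coe_eq_zero_iff ⟨a, hmem a ha⟩).1 (hpos a ha).ne'
      have h4 := abs_pos.2 h3
      simp only at h2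
      rw [Finset.mem_Icc]
      omega)
    (fun a ha => hff ⟨a, hmem a ha⟩ (hpos a ha))
  rw [Finset.sum_const, nsmul_one, Int.card_Icc, show ((n : ℤ) + 1 - 1).toNat = n by omega,
    ZMod.natCast_eq_zero_iff] at h
  exact (Nat.not_even_iff_odd.2 hn) (even_iff_two_dvd.2 h)

/-- A sorted involution has only fixed points in the diagonal blocks. -/
theorem apply_eq_self_of_signedBlock_eq {n : ℕ} {b : Bool} {S : Finset (Fin n)}
    {π : SignedPerm n} (hinv : π⁻¹ = π) (hπ : Des b π ⊆ S) {a : Omega n} (ha : 0 < a.1)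
    (h : signedBlock S (π.1 a).1 = signedBlock S a.1) : (π.1 a).1 = a.1 := by
  have hpos : 0 < (π.1 a).1 := by rwa [← signedBlock_pos_iff S, h, signedBlock_pos_iff]
  have key : ∀ x : ℤ, 0 < x → orderKey n b x = x := by
    intro x hx
    cases b
    · exact orderKey_false n x
    · rw [orderKey_true, if_neg hx.not_gt]
  have h1 := apply_apply_of_inv_eq hinv a
  -- If `a ≤ π(a)` in one block, sortedness gives `π(a) ≤ π(π(a)) = a`; the other case is symmetric.
  rcases le_total a.1 (π.1 a).1 with hle | hle
  · have h2 := orderKey_le_of_signedBlock_eq hπ ha hle h.symm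
    rw [h1, key _ hpos, key _ ha] at h2
    omega
  · have h2 := orderKey_le_of_signedBlock_eq hπ hpos hle h
    rw [h1, key _ hpos, key _ ha] at h2
    omega

/-- Along a block, negative values of an `r`-sorted `π` grow in absolute value, so the involution `a
↦ -π(a)` is increasing there and fixes `a`. In the natural order it would be decreasing, and the
argument fails. -/
theorem apply_eq_neg_of_signedBlock_eq_neg {n : ℕ} {S : Finset (Fin n)}
    {π : SignedPerm n} (hinv : π⁻¹ = π) (hπ : Des true π ⊆ S) {a : Omega n} (ha : 0 < a.1)
    (h : signedBlock S (π.1 a).1 = -signedBlock S a.1) : (π.1 a).1 = -a.1 := by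
  have hneg : (π.1 a).1 < 0 := by
    rw [← signedBlock_lt_zero_iff S, h, neg_lt_zero, signedBlock_pos_iff]
    exact ha
  have h1 : π.1 (-π.1 a) = -a := by rw [map_neg, apply_apply_of_inv_eq hinv]
  have h' : signedBlock S (-π.1 a).1 = signedBlock S a.1 := by
    rw [Omega.coe_neg, signedBlock_neg, h, neg_neg]
  have hpos : 0 < (-π.1 a).1 := by rw [Omega.coe_neg]; omega
  rcases le_total a.1 (-π.1 a).1 with hle | hle
  · have h2 := orderKey_le_of_signedBlock_eq hπ ha hle h'.symm
    rw [h1] at h2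
    simp only [Omega.coe_neg] at hle h2
    rw [orderKey_true, orderKey_true, if_pos hneg, if_pos (by omega)] at h2
    omega
  · have h2 := orderKey_le_of_signedBlock_eq hπ hpos hle h'
    rw [h1] at h2
    simp only [Omega.coe_neg] at hle h2
    rw [orderKey_true, orderKey_true, if_pos hneg, if_pos (by omega)] at h2
    omega

/-- Without descents all positive elements form one block attached to `0`, so `π(1)` is positive and
in the block of `1`, making `1` a fixed point. -/
theorem Des_ne_empty {n : ℕ} (hn : 0 < n) (b : Bool) {π : SignedPerm n}
    (hπ : π ∈ fixedPointFreeSignedInvolutions n) : Des b π ≠ ∅ := by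
  intro h
  obtain ⟨hinv, hfix⟩ := mem_fixedPointFreeSignedInvolutions.1 hπ
  let a : Omega n := ⟨1, by omega, by omega⟩
  have hone : ∀ c : Omega n, 0 < c.1 → signedBlock (∅ : Finset (Fin n)) c.1 = 1 := by
    intro c hc
    rw [signedBlock_of_pos _ hc]
    simp [blockIndex]
  have ha : 0 < a.1 := one_pos
  have h1 := apply_pos_of_signedBlock_eq_one h.subset (hone a ha)
  exact (hfix a ha).1
    (apply_eq_self_of_signedBlock_eq hinv h.subset ha ((hone _ h1).trans (hone a ha).symm))

/-- No fixed-point-free involution that is sorted for the `r`-order maps a block to itself, up to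
sign. -/
theorem signedBlock_apply_ne {n : ℕ} {S : Finset (Fin n)} {π : SignedPerm n}
    (hπ : π ∈ fixedPointFreeSignedInvolutions n) (h : Des true π ⊆ S) {a : Omega n}
    (ha : 0 < a.1) : signedBlock S (π.1 a).1 ≠ signedBlock S a.1 ∧
      signedBlock S (π.1 a).1 ≠ -signedBlock S a.1 := by
  obtain ⟨hinv, hfix⟩ := mem_fixedPointFreeSignedInvolutions.1 hπ
  exact ⟨fun h1 => (hfix a ha).1 (apply_eq_self_of_signedBlock_eq hinv h ha h1),
    fun h1 => (hfix a ha).2 (apply_eq_neg_of_signedBlock_eq_neg hinv h ha h1)⟩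

/-- The matrix of the `r`-sorted `π` vanishes on the diagonal and antidiagonal, where a fixed or
negated point of `σ` would be counted. -/
theorem mem_fixedPointFreeSignedInvolutions_of_blockCount_eq {n : ℕ} {b : Bool}
    {S : Finset (Fin n)} {π σ : SignedPerm n} (hπ : π ∈ fixedPointFreeSignedInvolutions n)
    (h : Des true π ⊆ S) (hσ : Des b σ ⊆ S) (hσ' : Des b σ⁻¹ ⊆ S)
    (hc : blockCount S S σ = blockCount S S π) : σ ∈ fixedPointFreeSignedInvolutions n := by
  obtain ⟨hinv, -⟩ := mem_fixedPointFreeSignedInvolutions.1 hπ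
  have hz : ∀ (a : Omega n) (j : ℤ), 0 < a.1 → j = signedBlock S a.1 ∨ j = -signedBlock S a.1 →
      blockCount S S σ (signedBlock S a.1) j = 0 := by
    intro a j ha hj
    rw [hc, blockCount_eq_zero_iff]
    intro c hca
    have hc0 : 0 < c.1 := by rwa [← signedBlock_pos_iff S, hca, signedBlock_pos_iff]
    have := signedBlock_apply_ne hπ h hc0
    rw [hca] at this
    rcases hj with rfl | rfl
    · exact this.1
    · exact this.2
  refine mem_fixedPointFreeSignedInvolutions.2
    ⟨inv_eq_of_blockCount_eq hinv hσ hσ' hc, fun a ha => ⟨fun h1 => ?_, fun h1 => ?_⟩⟩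
  · exact (blockCount_eq_zero_iff _ _ _ _ _).1 (hz a _ ha (Or.inl rfl)) a rfl (by rw [h1])
  · exact (blockCount_eq_zero_iff _ _ _ _ _).1 (hz a _ ha (Or.inr rfl)) a rfl
      (by rw [h1, signedBlock_neg])

/-! ### The extra involution for the natural order -/

/-- The map sending `a > 0` to `a - (n + 1)`. -/
def shiftFun {n : ℕ} (a : Omega n) : Omega n :=
  ⟨if 0 < a.1 then a.1 - (n + 1) else if a.1 < 0 then a.1 + (n + 1) else 0, by
    have := a.2
    split_ifs <;> omega⟩

theorem shiftFun_involutive {n : ℕ} : Function.Involutive (shiftFun (n := n)) := by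
  intro a
  have := a.2
  refine Subtype.ext ?_
  simp only [shiftFun]
  split_ifs <;> omega

/-- The signed permutation with entries `-n, …, -2, -1`. -/
def shift (n : ℕ) : SignedPerm n :=
  ⟨shiftFun_involutive.toPerm, by
    intro a
    refine Subtype.ext ?_
    simp only [Function.Involutive.coe_toPerm, Omega.coe_neg, shiftFun]
    split_ifs <;> omega⟩

theorem shift_apply_of_pos {n : ℕ} {a : Omega n} (ha : 0 < a.1) :
    ((shift n).1 a).1 = a.1 - (n + 1) := if_pos ha

theorem shift_mem {n : ℕ} (hn : Even n) : shift n ∈ fixedPointFreeSignedInvolutions n := by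
  obtain ⟨m, hm⟩ := hn
  refine mem_fixedPointFreeSignedInvolutions.2 ⟨?_, fun a ha => ?_⟩
  · exact Subtype.ext (Function.Involutive.toPerm_symm shiftFun_involutive)
  -- `a - (n + 1) = -a` would make `n + 1` even.
  · rw [shift_apply_of_pos ha]
    omega

theorem DesNat_shift {n : ℕ} (hn : 0 < n) : (shift n).DesNat = {⟨0, hn⟩} := by
  have hs : ∀ i : Fin n, (shift n).entry i.succ = (i.1 : ℤ) - n := by
    intro i
    have h1 : (Omega.ofFin i.succ : Omega n).1 = (i.1 : ℤ) + 1 := by simp [Omega.ofFin]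
    rw [entry, shift_apply_of_pos (by omega), h1]
    ring
  ext i
  simp only [DesNat, Finset.mem_filter, Finset.mem_univ, true_and, Finset.mem_singleton,
    Fin.ext_iff, hs]
  rcases Nat.eq_zero_or_pos i.1 with h0 | h0
  · rw [show i.castSucc = 0 from Fin.ext h0, entry_zero]
    omega
  · have h2 := hs ⟨i.1 - 1, by omega⟩
    rw [show (⟨i.1 - 1, by omega⟩ : Fin n).succ = i.castSucc from
      Fin.ext (by simp only [Fin.succ_mk, Fin.val_castSucc]; omega)] at h2
    simp only at h2
    omega

theorem card_desR_eq_one_lt {n : ℕ} (hn : 0 < n) (he : Even n) :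
    ((fixedPointFreeSignedInvolutions n).filter (fun π => π.desR = 1)).card <
      ((fixedPointFreeSignedInvolutions n).filter (fun π => π.desNat = 1)).card := by
  classical
  set A := (fixedPointFreeSignedInvolutions n).filter (fun π => π.desR = 1)
  set B := (fixedPointFreeSignedInvolutions n).filter (fun π => π.desNat = 1)
  have hex : ∀ π : SignedPerm n, ∃ σ : SignedPerm n, π ∈ A →
      σ ∈ fixedPointFreeSignedInvolutions n ∧ Des false σ = Des true π ∧
        blockCount (Des true π) (Des true π) σ = blockCount (Des true π) (Des true π) π := by
    intro π
    by_cases hπ : π ∈ A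
    · obtain ⟨hJ, hd⟩ := Finset.mem_filter.1 hπ
      have hinv := (mem_fixedPointFreeSignedInvolutions.1 hJ).1
      obtain ⟨σ, h1, h2, h3⟩ := exists_sorted_blockCount_eq (b := true) false (π := π)
        (subset_refl (Des true π)) (T := Des true π) (by rw [hinv])
      have hσ := mem_fixedPointFreeSignedInvolutions_of_blockCount_eq hJ (subset_refl _) h1 h2 h3
      -- `Des true π` has one element and `Des false σ` is nonempty, so inclusion is equality.
      refine ⟨σ, fun _ => ⟨hσ, Finset.eq_of_subset_of_card_le h1 ?_, h3⟩⟩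
      rw [desR_eq, hd]
      exact Finset.card_pos.2 (Finset.nonempty_iff_ne_empty.2 (Des_ne_empty hn _ hσ))
    · exact ⟨π, fun h => absurd h hπ⟩
  choose φ hφ using hex
  have hB : shift n ∈ B :=
    Finset.mem_filter.2 ⟨shift_mem he, by rw [desNat, DesNat_shift hn, Finset.card_singleton]⟩
  refine lt_of_le_of_lt (Finset.card_le_card_of_injOn φ ?_ ?_) (Finset.card_erase_lt_of_mem hB)
  · intro π hπ
    rw [Finset.mem_coe] at hπ
    obtain ⟨h1, h2, -⟩ := hφ π hπ
    obtain ⟨hJ, hd⟩ := Finset.mem_filter.1 hπ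
    rw [Finset.mem_coe, Finset.mem_erase]
    refine ⟨fun hw => ?_, Finset.mem_filter.2 ⟨h1, by rw [← desNat_eq, h2, desR_eq, hd]⟩⟩
    rw [hw, Des_false, DesNat_shift hn] at h2
    -- If `shift n` were hit, the only cut would be at `0`: block index `1`, hence signed block `2`,
    -- for every positive element. Then `π(1)` lies in block `2` or `-2`, which is excluded.
    have hblock : ∀ c : Omega n, 0 < c.1 → signedBlock (Des true π) c.1 = 2 := by
      intro c hc
      rw [signedBlock_of_pos _ hc, ← h2, blockIndex, Finset.filter_singleton,
        if_pos (by simp only; omega), Finset.card_singleton]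
      rfl
    let a : Omega n := ⟨1, by omega, by omega⟩
    have ha : 0 < a.1 := one_pos
    have hne := signedBlock_apply_ne hJ (subset_refl _) ha
    rw [hblock a ha] at hne
    rcases lt_trichotomy (π.1 a).1 0 with h0 | h0 | h0
    · have h3 := hblock (-π.1 a) (by rw [Omega.coe_neg]; omega)
      rw [Omega.coe_neg, signedBlock_neg] at h3
      omega
    · exact absurd ((π.coe_eq_zero_iff a).1 h0) ha.ne'
    · exact hne.1 (hblock _ h0)
  · intro π hπ ρ hρ h
    rw [Finset.mem_coe] at hπ hρ
    obtain ⟨-, h2, h3⟩ := hφ π hπ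
    obtain ⟨-, h2', h3'⟩ := hφ ρ hρ
    -- The image recovers `S` as its own descent set, then the matrix, and hence `π`.
    have hS : Des true π = Des true ρ := by rw [← h2, ← h2', h]
    have hπi := (mem_fixedPointFreeSignedInvolutions.1 (Finset.mem_filter.1 hπ).1).1
    have hρi := (mem_fixedPointFreeSignedInvolutions.1 (Finset.mem_filter.1 hρ).1).1
    rw [← hS] at h3'
    refine eq_of_blockCount_eq (b := true) (subset_refl (Des true π)) hS.symm.subset
      (T := Des true π) (by rw [hπi]) (by rw [hρi, hS]) ?_
    rw [← h3, ← h3', h]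

theorem not_equidistributed_des {n : ℕ} (hn : 0 < n) (he : Even n) :
    ¬ Equidistributed (fixedPointFreeSignedInvolutions n)
      (fun π => π.desNat) (fun π => π.desR) :=
  fun h => (card_desR_eq_one_lt hn he).ne' (h 1)

end SignedPerm

theorem mainTheorem3 (n : ℕ) (hn : 0 < n) :
    -- the pairs are equidistributed over the whole group
    Equidistributed (Finset.univ : Finset (SignedPerm n))
      (fun π => (π.desNat, π.idesNat)) (fun π => (π.desR, π.idesR)) ∧
    twoSidedEulerianNat n = twoSidedEulerianR n ∧
    -- equidistribution over the signed involutions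
    Equidistributed (signedInvolutions n)
      (fun π => π.desNat) (fun π => π.desR) ∧
    Equidistributed (signedInvolutions n)
      (fun π => (π.desNat, π.idesNat)) (fun π => (π.desR, π.idesR)) ∧
    involutionEulerianNat n = involutionEulerianR n ∧
    -- no equidistribution over the fixed-point-free signed involutions, unless there are none
    (Odd n → fixedPointFreeSignedInvolutions n = ∅) ∧
    (Even n →
      ¬ Equidistributed (fixedPointFreeSignedInvolutions n)
          (fun π => π.desNat) (fun π => π.desR) ∧
      ¬ Equidistributed (fixedPointFreeSignedInvolutions n)
          (fun π => (π.desNat, π.idesNat)) (fun π => (π.desR, π.idesR))) := by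
  have h2 := SignedPerm.equidistributed_des_signedInvolutions n
  have h1 := SignedPerm.equidistributed_des_pair n
  refine ⟨h1, ?_, h2, SignedPerm.equidistributed_des_pair_signedInvolutions n, ?_,
    SignedPerm.fixedPointFreeSignedInvolutions_eq_empty, fun he => ⟨?_, fun h => ?_⟩⟩
  · exact h1.sum_eq (fun d => MvPolynomial.X 0 ^ d.1 * MvPolynomial.X 1 ^ d.2)
  · exact h2.sum_eq (fun d => Polynomial.X ^ d)
  · exact SignedPerm.not_equidistributed_des hn he
  · exact SignedPerm.not_equidistributed_des hn he (h.comp Prod.fst)
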